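/- Let $G$ be a finite graph. A forcing set of a perfect matching $M$ of $G$ is a subset $S\subseteq M$ that is contained in no perfect matching of $G$ other than $M$; the forcing number $f(G,M)$ is the smallest size of a forcing set of $M$; the forcing polynomial of $G$ is $F(G,x)=\sum_{M} x^{f(G,M)}$, the sum being over all perfect matchings $M$ of $G$. For $n\ge 1$ let $G_n$ be the polyomino graph with $4n$ squares that has the vertices $u_0,v_0$ and $u_i,v_i,w_i,z_i$ ($1\le i\le 2n$) and the edges $u_iv_i$ ($0\le i\le 2n$), $u_iu_{i+1}$ and $v_iv_{i+1}$ ($0\le i\le 2n-1$), $w_iu_i$ and $v_iz_i$ ($1\le i\le 2n$), and $w_iw_{i+1}$ and $z_iz_{i+1}$ for odd $i$ with $1\le i\le 2n-1$. Let $G_0$ be the null graph (no vertices; its only perfect matching is empty, with forcing number $0$). Theorem. For every integer $n\ge 0$, $$F(G_n,x)=2^{2n}x^{2n}+x^n\sum_{m=0}^{n-1}\bigl(A_{n,m}-B_{n,m}\bigr)x^m,$$ where $$A_{n,m}=\sum_{i=\max\{\lceil n/3\rceil,\,m\}}^{n}\ \sum_{j=\max\{\lceil (n-i)/2\rceil,\,m+n-2i\}}^{n-i}\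 \sum_{k=m-(i+2j-n)}^{m}(-1)^{i+2j-n}\,2^{n+2m-i}\,3^{i-j-k}\binom{i}{j}\binom{j}{n-i-j}\binom{i-j}{k}\binom{i+2j-n}{m-k},$$ $$B_{n,m}=\sum_{i=\max\{\lceil (n-1)/3\rceil,\,m\}}^{n-1}\ \sum_{j=\max\{\lceil (n-i-1)/2\rceil,\,m+n-2i-1\}}^{n-i-1}\ \sum_{k=m-(i+2j-n+1)}^{m}(-1)^{i+2j-n+1}\,2^{n+2m-i-1}\,3^{i-j-k}\binom{i}{j}\binom{j}{n-i-j-1}\binom{i-j}{k}\binom{i+2j-n+1}{m-k}.$$ Here $\binom{a}{b}=0$ unless $0\le b\le a$, and a summand containing a zero binomial coefficient is $0$. -/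

import Mathlib

open Polynomial

/-- `S` is a forcing set of the perfect matching `M` of `G`: a finite set of edges of `M` that is
contained in no perfect matching of `G` other than `M`. -/
def IsForcingSet {V : Type*} {G : SimpleGraph V} (M : G.Subgraph) (S : Finset (Sym2 V)) : Prop :=
  (S : Set (Sym2 V)) ⊆ M.edgeSet ∧
    ∀ M' : G.Subgraph, M'.IsPerfectMatching → (S : Set (Sym2 V)) ⊆ M'.edgeSet → M' = M

/-- The forcing number `f(G, M)` of a perfect matching `M`: the least size of a forcing set. -/
noncomputable def forcingNumber {V : Type*} {G : SimpleGraph V} (M : G.Subgraph) : ℕ :=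
  sInf {k : ℕ | ∃ S : Finset (Sym2 V), IsForcingSet M S ∧ S.card = k}

open scoped Classical in
/-- The forcing polynomial `F(G, x) = ∑ x ^ f(G, M)`, the sum being over all perfect matchings `M`
of the finite graph `G`. -/
noncomputable def forcingPolynomial {V : Type*} [Fintype V] (G : SimpleGraph V) : ℤ[X] :=
  ∑ M : G.Subgraph with M.IsPerfectMatching, X ^ forcingNumber M

/-- A perfect matching of a finite graph has a forcing set, namely its whole edge set, so the
infimum in `forcingNumber` is a minimum. -/
theorem exists_isForcingSet {V : Type*} [Fintype V] {G : SimpleGraph V} (M : G.Subgraph)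
    (hM : M.IsPerfectMatching) : ∃ S : Finset (Sym2 V), IsForcingSet M S := by
  refine ⟨(Set.toFinite M.edgeSet).toFinset, by simp, fun M' hM' h => ?_⟩
  simp only [Set.Finite.coe_toFinset] at h
  have hle : ∀ a b, M.Adj a b → M'.Adj a b := fun a b hab => h (show s(a, b) ∈ M.edgeSet from hab)
  refine SimpleGraph.Subgraph.ext ?_ ?_
  · rw [SimpleGraph.Subgraph.isSpanning_iff.1 hM'.2, SimpleGraph.Subgraph.isSpanning_iff.1 hM.2]
  · funext a b
    refine propext ⟨fun hab => ?_, hle a b⟩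
    obtain ⟨c, hc, -⟩ := hM.1 (hM.2 a)
    obtain ⟨d, -, hd⟩ := hM'.1 (hM'.2 a)
    rw [hd b hab, ← hd c (hle a c hc)]
    exact hc

/-- The vertices of `G_n`, as points `(i, r)` of the plane grid: `i` is the column, `0 ≤ i ≤ 2 n`,
and `r` is the row, the rows `0, 1, 2, 3` containing the vertices `w_i, u_i, v_i, z_i`
respectively. Column `0` contains `u_0` and `v_0` only. `G_0` is the null graph, which has no
vertices. -/
abbrev PolyominoVertex (n : ℕ) : Type :=
  {p : Fin (2 * n + 1) × Fin 4 // 0 < n ∧ (p.1.val = 0 → p.2 = 1 ∨ p.2 = 2)}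

/-- The polyomino graph `G_n` with `4 n` squares. Vertical edges: `w_i u_i`, `u_i v_i`, `v_i z_i`.
Horizontal edges: `u_i u_{i+1}` and `v_i v_{i+1}` for every `i`, and `w_i w_{i+1}` and
`z_i z_{i+1}` for odd `i` only. So the two middle rows form a straight chain of `2 n` squares, and
every second one of these (the second, the fourth, …, the last) has one further square attached
above and one below. -/
def polyominoGraph (n : ℕ) : SimpleGraph (PolyominoVertex n) :=
  SimpleGraph.fromRel fun a b =>
    (a.1.1 = b.1.1 ∧ a.1.2.val + 1 = b.1.2.val) ∨
    (a.1.2 = b.1.2 ∧ a.1.1.val + 1 = b.1.1.val ∧ (a.1.2 = 1 ∨ a.1.2 = 2 ∨ Odd a.1.1.val))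

/-! The graph consists of the edge `u₀v₀` followed by `n` blocks of eight vertices, neighbouring
pieces being joined by two horizontal edges. A block has four vertices of each colour of the
bipartition, and the two joining edges end in opposite colours, so a perfect matching uses both of
them or neither. A matching is therefore a word of `n` letters: a block is split (four ways), or its
inner left vertices are matched to each other or linked to the preceding column. The only constraint
is that a linked letter does not follow a split one (`block_structure`, `wordMatching_wordOf`,
`sum_isPerfectMatching`).

The forcing number is a sum over letters, `cost`. A split letter costs 2 and any other letter costs
1, except that a linked letter met in the phase `tied` is free. For the lower bound, each unit of
cost has its own alternating square, and these squares are vertex-disjoint (`IsWord.flipWord_spec`),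
so a forcing set needs an edge from each (`IsWord.card_le_card`). For the upper bound, one matching
edge per unit lets the word be recovered from left to right (`IsWord.eq_of_mate_forcingVertex`).

Since the cost of a letter depends only on a three-valued phase, the forcing polynomial comes from
iterating a 3 × 3 transfer matrix (`sum_prod_weight`). Its characteristic polynomial is `λ³ - (3x +
4x²)λ² + (2x² + 8x³)λ - 4x³`, which gives `F(G_n, x) = xⁿ (T_n - T_{n-1})` for `T = transferPoly`
(`transfer_iterate_free`). Expanding the geometric series for `T` turns its coefficients into
`A_{n,m}` and `B_{n,m}` (`transferPoly_coeff`); the top coefficient `4ⁿ` of `T_n` is the separate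
leading term. -/

/-! ### Coefficients of the inverse of a cubic power series -/

theorem coeff_C_add_C_mul_X_pow {R : Type*} [CommRing R] (u v : R) (j d : ℕ) :
    ((C u + C v * X : R[X]) ^ j).coeff d = (j.choose d : R) * u ^ (j - d) * v ^ d := by
  rw [add_comm, add_pow, finsetSum_coeff]
  have h : ∀ k ∈ Finset.range (j + 1),
      ((C v * X : R[X]) ^ k * C u ^ (j - k) * (j.choose k : R[X])).coeff d =
        if k = d then (j.choose d : R) * u ^ (j - d) * v ^ d else 0 := by
    intro k _
    rw [mul_pow, ← C_pow, ← C_pow, ← C_eq_natCast,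
      show C (v ^ k) * X ^ k * C (u ^ (j - k)) * C (j.choose k : R) =
        C ((j.choose k : R) * u ^ (j - k) * v ^ k) * X ^ k by simp only [C_mul]; ring,
      coeff_C_mul_X_pow]
    split_ifs with h1 h2 h2
    · rw [h2]
    · exact absurd h1.symm h2
    · exact absurd h2.symm h1
    · rfl
  rw [Finset.sum_congr rfl h, Finset.sum_ite_eq']
  split_ifs with hd
  · rfl
  · rw [Nat.choose_eq_zero_of_lt (by simpa using hd)]; simp

/-- The coefficient of `t ^ n` in `(1 - a t - b t ^ 2 - c t ^ 3)⁻¹`. -/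
def trinomialSum {R : Type*} [CommRing R] (a b c : R) (n : ℕ) : R :=
  ∑ i ∈ Finset.range (n + 1), ∑ j ∈ Finset.range (n - i + 1),
    (i.choose j : R) * (j.choose (n - i - j) : R) * a ^ (i - j) * b ^ (i + 2 * j - n) *
      c ^ (n - i - j)

/-- Among the `i` factors, `j` contribute `X * (C b + C c * X)`, and `n - i - j` of these contribute
`c`. Where a natural subtraction is truncated, one of the binomials vanishes. -/
theorem coeff_trinomial_pow {R : Type*} [CommRing R] (a b c : R) {i n : ℕ} (hi : i ≤ n) :
    ((X * (C a + X * (C b + C c * X)) : R[X]) ^ i).coeff n =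
      ∑ j ∈ Finset.range (n - i + 1),
        (i.choose j : R) * (j.choose (n - i - j) : R) * a ^ (i - j) * b ^ (i + 2 * j - n) *
          c ^ (n - i - j) := by
  obtain ⟨d, rfl⟩ := Nat.exists_eq_add_of_le' hi
  rw [mul_pow, coeff_X_pow_mul, add_comm (C a), add_pow, finsetSum_coeff]
  have h : ∀ j ∈ Finset.range (i + 1),
      ((X * (C b + C c * X) : R[X]) ^ j * C a ^ (i - j) * (i.choose j : R[X])).coeff d =
        if j < d + 1 then (i.choose j : R) * (j.choose (d - j) : R) * a ^ (i - j) *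
          b ^ (2 * j - d) * c ^ (d - j) else 0 := by
    intro j _
    rw [mul_pow, ← C_pow, ← C_eq_natCast,
      show (X : R[X]) ^ j * (C b + C c * X) ^ j * C (a ^ (i - j)) * C (i.choose j : R) =
        C ((i.choose j : R) * a ^ (i - j)) * (X ^ j * (C b + C c * X) ^ j) by
          simp only [C_mul]; ring, coeff_C_mul]
    split_ifs with hj
    · obtain ⟨e, rfl⟩ := Nat.exists_eq_add_of_le' (Nat.lt_succ_iff.1 hj)
      rw [coeff_X_pow_mul, coeff_C_add_C_mul_X_pow, show 2 * j - (e + j) = j - e by omega,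
        Nat.add_sub_cancel]
      ring
    · rw [coeff_X_pow_mul', if_neg (by omega), mul_zero]
  rw [Finset.sum_congr rfl h, ← Finset.sum_filter, show d + i - i = d by omega]
  refine Finset.sum_subset_zero_on_sdiff ?_ ?_ ?_
  · intro j; simp
  · intro j hj
    have : i < j := by
      simp only [Finset.mem_sdiff, Finset.mem_range, Finset.mem_filter] at hj; omega
    rw [Nat.choose_eq_zero_of_lt this]; simp
  · intro j _
    rw [show i + 2 * j - (d + i) = 2 * j - d by omega]

/-- The `i`-th power is divisible by `X ^ i`, so the geometric series may be cut off anywhere from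
`n` on. The free cut-off `N` gives different coefficients a common range of summation. -/
theorem trinomialSum_eq {R : Type*} [CommRing R] (a b c : R) {n N : ℕ} (hN : n ≤ N) :
    trinomialSum a b c n =
      ∑ i ∈ Finset.range (N + 1), ((X * (C a + X * (C b + C c * X)) : R[X]) ^ i).coeff n := by
  rw [trinomialSum]
  refine Finset.sum_subset_zero_on_sdiff ?_ ?_ ?_
  · intro j; simp only [Finset.mem_range]; omega
  · intro i hi
    rw [mul_pow, coeff_X_pow_mul', if_neg]
    simp only [Finset.mem_sdiff, Finset.mem_range] at hi; omega
  · intro i hi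
    rw [coeff_trinomial_pow a b c (by simp only [Finset.mem_range] at hi; omega)]

theorem trinomialSum_add_three {R : Type*} [CommRing R] (a b c : R) (n : ℕ) :
    trinomialSum a b c (n + 3) = a * trinomialSum a b c (n + 2) +
      b * trinomialSum a b c (n + 1) + c * trinomialSum a b c n := by
  rw [trinomialSum_eq a b c (N := n + 3) le_rfl, trinomialSum_eq a b c (N := n + 2) le_rfl,
    trinomialSum_eq a b c (n := n + 1) (N := n + 2) (by omega),
    -- The term `i = 0` splits off; it is the coefficient of `1` in positive degree. Each remaining
    -- power gives up one factor, whose three monomials shift the degree by 1, 2 and 3.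
    trinomialSum_eq a b c (n := n) (N := n + 2) (by omega), Finset.sum_range_succ',
    Finset.mul_sum, Finset.mul_sum, Finset.mul_sum, ← Finset.sum_add_distrib,
    ← Finset.sum_add_distrib, pow_zero, coeff_one, if_neg (by omega), add_zero]
  refine Finset.sum_congr rfl fun i _ => ?_
  generalize hq : (X * (C a + X * (C b + C c * X)) : R[X]) = q
  rw [pow_succ', ← hq, hq, show q * q ^ i = C a * (X ^ 1 * q ^ i) + C b * (X ^ 2 * q ^ i) +
    C c * (X ^ 3 * q ^ i) by rw [← hq]; ring]
  rw [coeff_add, coeff_add, coeff_C_mul, coeff_C_mul, coeff_C_mul, coeff_X_pow_mul,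
    show n + 3 = n + 2 + 1 from rfl, coeff_X_pow_mul, show n + 2 + 1 = n + 1 + 2 from rfl,
    coeff_X_pow_mul]

/-- The power series coefficients of `(1 - (3 + 4 x) t + 2 (1 + 4 x) t ^ 2 - 4 t ^ 3)⁻¹`. -/
noncomputable def transferPoly (n : ℕ) : ℤ[X] :=
  trinomialSum (C 3 + C 4 * X) (C (-2) * (C 1 + C 4 * X)) (C 4) n

theorem transferPoly_zero : transferPoly 0 = 1 := by
  simp [transferPoly, trinomialSum]

theorem transferPoly_one : transferPoly 1 = 3 + 4 * X := by
  simp [transferPoly, trinomialSum, Finset.sum_range_succ]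

theorem transferPoly_two : transferPoly 2 = 7 + 16 * X + 16 * X ^ 2 := by
  simp [transferPoly, trinomialSum, Finset.sum_range_succ]
  ring

theorem transferPoly_add_three (n : ℕ) : transferPoly (n + 3) =
    (C 3 + C 4 * X) * transferPoly (n + 2) + C (-2) * (C 1 + C 4 * X) * transferPoly (n + 1) +
      C 4 * transferPoly n :=
  trinomialSum_add_three _ _ _ n

/-- In the recurrence only the product with `4 * X` reaches the top degree, which multiplies the
leading coefficient by 4. -/
theorem transferPoly_coeff_of_le (n m : ℕ) (h : n ≤ m) :
    (transferPoly n).coeff m = if m = n then 4 ^ n else 0 := by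
  induction n using Nat.strong_induction_on generalizing m with
  | _ n ih =>
    match n, ih, h with
    | 0, _, _ => rw [transferPoly_zero, coeff_one]; simp
    | 1, _, h =>
      rw [transferPoly_one]
      obtain ⟨m, rfl⟩ := Nat.exists_eq_add_of_le' h
      rcases m with _ | m <;> simp [coeff_X, coeff_ofNat_succ]
    | 2, _, h =>
      rw [transferPoly_two]
      obtain ⟨m, rfl⟩ := Nat.exists_eq_add_of_le' h
      rcases m with _ | m <;> simp [coeff_X, coeff_ofNat_succ, coeff_X_pow]
    | n + 3, ih, h =>
      obtain ⟨m, rfl⟩ := Nat.exists_eq_add_of_le' h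
      have e : transferPoly (n + 3) = C 3 * transferPoly (n + 2) + C 4 * (X * transferPoly (n + 2))
          + C (-2) * transferPoly (n + 1) + C (-8) * (X * transferPoly (n + 1)) +
          C 4 * transferPoly n := by
        rw [transferPoly_add_three]
        simp only [map_neg, map_ofNat, map_one]; ring
      rw [e, show m + (n + 3) = m + n + 2 + 1 by omega]
      simp only [coeff_add, coeff_C_mul, coeff_X_mul]
      rw [ih (n + 2) (by omega) _ (by omega), ih (n + 2) (by omega) _ (by omega),
        ih (n + 1) (by omega) _ (by omega), ih (n + 1) (by omega) _ (by omega),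
        ih n (by omega) _ (by omega)]
      rcases m with _ | m
      · rw [if_neg (by omega), if_pos (by omega), if_neg (by omega), if_neg (by omega),
          if_neg (by omega), if_pos (by omega)]
        ring
      · repeat rw [if_neg (by omega)]
        simp

/-- Here `k` and `m - k` are the degrees taken from the powers of `3 + 4x` and of `-2(1 + 4x)`. The
bounds of the three sums only discard terms with a vanishing binomial: nonzero ones force `m ≤ k +
(i + 2j - n) ≤ 2i + j - n ≤ i`. -/
theorem transferPoly_coeff (n m : ℕ) : (transferPoly n).coeff m =
    ∑ i ∈ Finset.Icc (max (n ⌈/⌉ 3) m) n,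
      ∑ j ∈ Finset.Icc (max ((n - i) ⌈/⌉ 2) (m + n - 2 * i)) (n - i),
        ∑ k ∈ Finset.Icc (m - (i + 2 * j - n)) m,
          (-1 : ℤ) ^ (i + 2 * j - n) * 2 ^ (n + 2 * m - i) * 3 ^ (i - j - k) *
            (i.choose j : ℤ) * (j.choose (n - i - j) : ℤ) *
            ((i - j).choose k : ℤ) * ((i + 2 * j - n).choose (m - k) : ℤ) := by
  set f : ℕ → ℕ → ℕ → ℤ := fun i j k =>
    (-1 : ℤ) ^ (i + 2 * j - n) * 2 ^ (n + 2 * m - i) * 3 ^ (i - j - k) *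
      (i.choose j : ℤ) * (j.choose (n - i - j) : ℤ) *
      ((i - j).choose k : ℤ) * ((i + 2 * j - n).choose (m - k) : ℤ) with hf
  have hz : ∀ i j k, (i < j ∨ j < n - i - j ∨ i - j < k ∨ i + 2 * j - n < m - k) →
      f i j k = 0 := by
    rintro i j k (h | h | h | h) <;> simp [hf, Nat.choose_eq_zero_of_lt h]
  have hcd : ∀ a b c : ℕ, 0 < b → (a ⌈/⌉ b ≤ c ↔ a ≤ b * c) := fun a b c hb => by
    rw [ceilDiv_le_iff_le_mul hb]
  have main : (transferPoly n).coeff m =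
      ∑ i ∈ Finset.range (n + 1), ∑ j ∈ Finset.range (n - i + 1), ∑ k ∈ Finset.range (m + 1),
        f i j k := by
    rw [transferPoly, trinomialSum, finsetSum_coeff]
    refine Finset.sum_congr rfl fun i hi => ?_
    rw [finsetSum_coeff]
    refine Finset.sum_congr rfl fun j hj => ?_
    simp only [Finset.mem_range] at hi hj
    by_cases hij : n ≤ i + 2 * j
    swap
    · rw [Nat.choose_eq_zero_of_lt (show j < n - i - j by omega), Finset.sum_eq_zero]
      · simp
      · intro k _; exact hz i j k (by omega)
    rw [mul_pow, ← C_pow, ← C_pow, ← C_eq_natCast, ← C_eq_natCast,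
      show ∀ p q : ℤ[X], ∀ u v s t : ℤ, C u * C v * p * (C s * q) * C t =
        C (u * v * s * t) * (p * q) by intros; simp only [C_mul]; ring, coeff_C_mul, coeff_mul,
      Finset.Nat.sum_antidiagonal_eq_sum_range_succ_mk, Finset.mul_sum]
    refine Finset.sum_congr rfl fun k hk => ?_
    simp only [Finset.mem_range] at hk
    rw [coeff_C_add_C_mul_X_pow, coeff_C_add_C_mul_X_pow, hf]
    -- The powers of two come from `-2`, from the two factors `4x`, and from the cubic coefficient
    -- `4`.
    have e2 : (2 : ℤ) ^ (n + 2 * m - i) =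
        2 ^ (i + 2 * j - n) * 4 ^ k * 4 ^ (m - k) * 4 ^ (n - i - j) := by
      rw [show (4 : ℤ) = 2 ^ 2 by norm_num, ← pow_mul, ← pow_mul, ← pow_mul, ← pow_add, ← pow_add,
        ← pow_add]
      congr 1; omega
    simp only [e2, show (-2 : ℤ) = -1 * 2 by norm_num, mul_pow, one_pow]
    ring
  rw [main]
  symm
  refine Finset.sum_subset_zero_on_sdiff ?_ ?_ ?_
  · intro i; simp only [Finset.mem_Icc, Finset.mem_range]; omega
  · intro i hi
    simp only [Finset.mem_sdiff, Finset.mem_Icc, Finset.mem_range, max_le_iff,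
      hcd n 3 _ (by norm_num)] at hi
    refine Finset.sum_eq_zero fun j hj => Finset.sum_eq_zero fun k hk => hz i j k ?_
    simp only [Finset.mem_range] at hj hk
    omega
  · intro i hi
    simp only [Finset.mem_Icc, max_le_iff] at hi
    refine Finset.sum_subset_zero_on_sdiff ?_ ?_ ?_
    · intro j; simp only [Finset.mem_Icc, Finset.mem_range]; omega
    · intro j hj
      simp only [Finset.mem_sdiff, Finset.mem_Icc, Finset.mem_range, max_le_iff,
        hcd _ 2 _ (by norm_num : 0 < 2)] at hj
      refine Finset.sum_eq_zero fun k hk => hz i j k ?_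
      simp only [Finset.mem_range] at hk
      omega
    · intro j hj
      refine Finset.sum_subset_zero_on_sdiff ?_ ?_ fun _ _ => rfl
      · intro k; simp only [Finset.mem_Icc, Finset.mem_range]; omega
      · intro k hk
        simp only [Finset.mem_sdiff, Finset.mem_Icc, Finset.mem_range] at hk
        exact hz i j k (by omega)

/-! ### Words, phases and costs -/

/-- The shape of a perfect matching on one block of three vertically adjacent squares.
`inl (p, q)`: the upper and the lower square carry two matching edges each, vertical ones if `p`
(resp. `q`). `inr h`: the top and bottom edges are matched, and the two inner vertices on the left
are matched to the preceding column if `h`, with each other otherwise. -/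
abbrev Letter : Type := (Bool × Bool) ⊕ Bool

/-- What matters of a word for the cost of its next letter: nothing was split yet or a linked pair
of blocks has occurred since (`free`), the last block is split (`split`), or only unlinked
blocks have occurred since the last split block (`tied`). -/
inductive Phase
  | free
  | split
  | tied

/-- The phase after one more letter. -/
def Phase.next : Phase → Letter → Phase
  | _, .inl _ => .split
  | .free, .inr _ => .free
  | .tied, .inr true => .free
  | _, .inr _ => .tied

/-- The contribution of a letter to the forcing number. -/
def Phase.cost : Phase → Letter → ℕ
  | _, .inl _ => 2
  | .tied, .inr true => 0
  | _, .inr _ => 1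

/-- The phase of the word `w` after the letter with index `k`; the letter `w 0` is not read. -/
def phase (w : ℕ → Letter) : ℕ → Phase
  | 0 => .free
  | k + 1 => (phase w k).next (w (k + 1))

/-- The words that encode the perfect matchings of the polyomino graph. The letters `1, …, n`
describe the blocks, the letter `0` stands for the single edge on the left. -/
structure IsWord (n : ℕ) (w : ℕ → Letter) : Prop where
  zero : w 0 = .inr false
  link : ∀ k, w (k + 1) = .inr true → (w k).isRight
  tail : ∀ k, n < k → w k = .inl (false, false)

/-- The infinite word with letters `w` at the indices `1, …, n`. -/
def extend {n : ℕ} (w : Fin n → Letter) (k : ℕ) : Letter :=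
  if k = 0 then .inr false else if h : k - 1 < n then w ⟨k - 1, h⟩ else .inl (false, false)

theorem extend_succ {n : ℕ} (w : Fin n → Letter) {k : ℕ} (h : k < n) :
    extend w (k + 1) = w ⟨k, h⟩ := by
  simp [extend, h]

theorem extend_of_lt {n : ℕ} (w : Fin n → Letter) {k : ℕ} (h : n < k) :
    extend w k = .inl (false, false) := by
  rw [extend, if_neg (by omega), dif_neg (by omega)]

theorem extend_snoc_of_le {n : ℕ} (w : Fin n → Letter) (l : Letter) {k : ℕ} (h : k ≤ n) :
    extend (Fin.snoc w l : Fin (n + 1) → Letter) k = extend w k := by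
  rcases k with _ | k
  · rfl
  · rw [extend_succ _ (by omega), extend_succ _ (by omega)]
    exact Fin.snoc_castSucc (α := fun _ => Letter) l w ⟨k, by omega⟩

theorem extend_snoc_last {n : ℕ} (w : Fin n → Letter) (l : Letter) :
    extend (Fin.snoc w l : Fin (n + 1) → Letter) (n + 1) = l := by
  rw [extend_succ _ (by omega)]
  exact Fin.snoc_last (α := fun _ => Letter) l w

theorem phase_congr {w w' : ℕ → Letter} {n : ℕ} (h : ∀ k ≤ n, w k = w' k) :
    ∀ k ≤ n, phase w k = phase w' k := by
  intro k hk
  induction k with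
  | zero => rfl
  | succ k ih => rw [phase, phase, ih (by omega), h _ hk]

theorem IsWord.extend_restrict {n : ℕ} {w : ℕ → Letter} (hw : IsWord n w) :
    extend (fun i : Fin n => w (i + 1)) = w := by
  funext k
  rcases k with _ | k
  · exact hw.zero.symm
  · by_cases h : k < n
    · rw [extend_succ _ h]
    · rw [extend_of_lt _ (by omega), hw.tail _ (by omega)]

theorem extend_injective {n : ℕ} : Function.Injective (extend (n := n)) := by
  intro w w' h
  funext i
  rw [← extend_succ w i.2, h, extend_succ]

/-- The total cost of the first `n` letters. -/
def cost (n : ℕ) (w : ℕ → Letter) : ℕ :=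
  ∑ k ∈ Finset.range n, (phase w k).cost (w (k + 1))

/-! ### The transfer operator on phases -/

/-- The weight of a letter, which vanishes if the letter may not follow. -/
noncomputable def Phase.weight : Phase → Letter → ℤ[X]
  | .split, .inr true => 0
  | s, l => X ^ s.cost l

/-- This makes admissibility of the next letter a function of the phase alone. -/
theorem phase_eq_split_iff {w : ℕ → Letter} (h0 : w 0 = .inr false) (k : ℕ) :
    phase w k = .split ↔ ¬ (w k).isRight := by
  rcases k with _ | k
  · simp [phase, h0]
  · rw [phase]
    rcases w (k + 1) with l | (_ | _) <;> rcases phase w k <;> simp [Phase.next]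

open scoped Classical in
theorem prod_weight {n : ℕ} (w : Fin n → Letter) :
    ∏ k ∈ Finset.range n, (phase (extend w) k).weight (extend w (k + 1)) =
      if IsWord n (extend w) then X ^ cost n (extend w) else 0 := by
  split_ifs with h
  · rw [cost, ← Finset.prod_pow_eq_pow_sum]
    refine Finset.prod_congr rfl fun k _ => ?_
    have h1 := h.link k
    have h2 := phase_eq_split_iff h.zero k
    rcases hp : phase (extend w) k <;> rcases hl : extend w (k + 1) with l | (_ | _) <;>
      simp_all [Phase.weight]
  · have : ∃ k, extend w (k + 1) = .inr true ∧ ¬ (extend w k).isRight := by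
      by_contra! hc
      exact h ⟨rfl, hc, fun k => extend_of_lt w⟩
    obtain ⟨k, hk, hk'⟩ := this
    have hkn : k < n := by
      by_contra hkn
      rw [extend_of_lt w (by omega)] at hk
      simp at hk
    refine Finset.prod_eq_zero (Finset.mem_range.2 hkn) ?_
    rw [(phase_eq_split_iff rfl k).2 hk', hk, Phase.weight]

/-- The transfer operator on functions of the phase. -/
noncomputable def transfer (g : Phase → ℤ[X]) (s : Phase) : ℤ[X] :=
  ∑ l : Letter, s.weight l * g (s.next l)

/-- The final function `g` is arbitrary for the sake of the induction: summing out the last letter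
replaces `g` by `transfer g`. -/
theorem sum_prod_weight (n : ℕ) (g : Phase → ℤ[X]) :
    ∑ w : Fin n → Letter, (∏ k ∈ Finset.range n,
      (phase (extend w) k).weight (extend w (k + 1))) * g (phase (extend w) n) =
      (transfer^[n] g) .free := by
  induction n generalizing g with
  | zero => simp [phase]
  | succ n ih =>
    rw [Function.iterate_succ_apply, ← ih, ← (Fin.snocEquiv fun _ => Letter).sum_comp,
      Fintype.sum_prod_type_right]
    refine Finset.sum_congr rfl fun w _ => ?_
    rw [transfer, Finset.mul_sum]
    refine Finset.sum_congr rfl fun l _ => ?_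
    change (∏ k ∈ Finset.range (n + 1), (phase (extend (Fin.snoc w l)) k).weight
      (extend (Fin.snoc w l) (k + 1))) * g (phase (extend (Fin.snoc w l)) (n + 1)) = _
    have hp := phase_congr (n := n) fun k hk => extend_snoc_of_le w l hk
    rw [Finset.prod_range_succ, phase, hp n le_rfl, extend_snoc_last, mul_assoc]
    congr 1
    refine Finset.prod_congr rfl fun k hk => ?_
    rw [Finset.mem_range] at hk
    rw [hp k hk.le, extend_snoc_of_le w l hk]

theorem transfer_apply (g : Phase → ℤ[X]) (s : Phase) : transfer g s =
    match s with
    | .free => 4 * X ^ 2 * g .split + 2 * X * g .free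
    | .split => 4 * X ^ 2 * g .split + X * g .tied
    | .tied => 4 * X ^ 2 * g .split + X * g .tied + g .free := by
  rcases s <;>
    simp [transfer, Fintype.sum_sum_type, Phase.weight, Phase.cost, Phase.next] <;> ring

theorem transfer_iterate_free (n : ℕ) :
    (transfer^[n] fun _ => 1) .free =
      X ^ n * (transferPoly n - if n = 0 then 0 else transferPoly (n - 1)) := by
  have hs : ∀ n, (transfer^[n + 1] fun _ => 1) = transfer (transfer^[n] fun _ => 1) :=
    fun n => Function.iterate_succ_apply' _ _ _
  induction n using Nat.strong_induction_on with
  | _ n ih =>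
    match n, ih with
    | 0, _ => simp [transferPoly_zero]
    | 1, _ => simp [transfer_apply, transferPoly_zero, transferPoly_one]; ring
    | 2, _ => simp [transfer_apply, transferPoly_two, transferPoly_one]; ring
    -- The case 3 is separate because the recurrence would reach back to index 0, where the
    -- subtracted term is 0 by convention.
    | 3, _ =>
      have := transferPoly_add_three 0
      simp only [Nat.zero_add] at this
      simp [transfer_apply, this, transferPoly_zero, transferPoly_two, transferPoly_one]; ring
    | n + 4, ih =>
      have h1 := ih (n + 1) (by omega)
      have h2 := ih (n + 2) (by omega)
      have h3 := ih (n + 3) (by omega)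
      -- Cayley–Hamilton for the transfer matrix.
      have hr : (transfer^[n + 4] fun _ => 1) .free =
          X * (3 + 4 * X) * (transfer^[n + 3] fun _ => 1) .free -
          2 * X ^ 2 * (1 + 4 * X) * (transfer^[n + 2] fun _ => 1) .free +
          4 * X ^ 3 * (transfer^[n + 1] fun _ => 1) .free := by
        rw [hs (n + 3), hs (n + 2), hs (n + 1)]
        simp only [transfer_apply]
        ring
      rw [hr, h1, h2, h3]
      have t1 := transferPoly_add_three (n + 1)
      have t2 := transferPoly_add_three n
      simp only [Nat.add_eq_zero_iff, show n + 4 ≠ 0 by omega, OfNat.ofNat_ne_zero,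
        and_false, one_ne_zero, if_false, show n + 4 - 1 = n + 3 by omega,
        show n + 3 - 1 = n + 2 by omega, show n + 2 - 1 = n + 1 by omega,
        show n + 1 - 1 = n by omega]
      rw [show n + 1 + 3 = n + 4 by omega, show n + 1 + 2 = n + 3 by omega,
        show n + 1 + 1 = n + 2 by omega] at t1
      rw [t1]
      simp only [map_neg, map_ofNat, map_one] at t2 ⊢
      linear_combination X ^ (n + 4) * t2

open scoped Classical in
theorem sum_word_cost (n : ℕ) :
    ∑ w : Fin n → Letter with IsWord n (extend w), (X : ℤ[X]) ^ cost n (extend w) =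
      X ^ n * (transferPoly n - if n = 0 then 0 else transferPoly (n - 1)) := by
  rw [Finset.sum_filter, ← transfer_iterate_free, ← sum_prod_weight]
  refine Finset.sum_congr rfl fun w _ => ?_
  rw [prod_weight, mul_one]

/-! ### From words to perfect matchings -/

/-- Whether the upper square of the block is split off with vertical edges. -/
def Letter.top : Letter → Bool
  | .inl (p, _) => p
  | .inr _ => false

/-- Whether the lower square of the block is split off with vertical edges. -/
def Letter.bot : Letter → Bool
  | .inl (_, q) => q
  | .inr _ => false

/-- The partner of the vertex in column `i` and row `r`, where `l` is the letter of its block, `o`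
the other column of the block, `e` the adjacent column outside the block, and `c` tells whether
the columns `i` and `e` are linked. -/
def localMate (l : Letter) (c : Bool) (i o e : ℕ) : Fin 4 → ℕ × Fin 4
  | 0 => if l.top then (i, 1) else (o, 0)
  | 1 => match l with
    | .inl (p, _) => if p then (i, 0) else (o, 1)
    | .inr _ => if c then (e, 1) else (i, 2)
  | 2 => match l with
    | .inl (_, q) => if q then (i, 3) else (o, 2)
    | .inr _ => if c then (e, 2) else (i, 1)
  | 3 => if l.bot then (i, 2) else (o, 3)

/-- The partner of the vertex in column `x.1` and row `x.2` in the matching encoded by `w`. -/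
def mate (w : ℕ → Letter) (x : ℕ × Fin 4) : ℕ × Fin 4 :=
  if x.1 % 2 = 1 then
    localMate (w (x.1 / 2 + 1)) (w (x.1 / 2 + 1) = .inr true) x.1 (x.1 + 1) (x.1 - 1) x.2
  else localMate (w (x.1 / 2)) (w (x.1 / 2 + 1) = .inr true) x.1 (x.1 - 1) (x.1 + 1) x.2

theorem mate_odd (w : ℕ → Letter) (k : ℕ) (r : Fin 4) : mate w (2 * k + 1, r) =
    localMate (w (k + 1)) (w (k + 1) = .inr true) (2 * k + 1) (2 * k + 2) (2 * k) r := by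
  rw [mate, if_pos (by dsimp only; omega), show (2 * k + 1, r).1 / 2 = k by dsimp only; omega]
  rfl

theorem mate_even (w : ℕ → Letter) (k : ℕ) (r : Fin 4) : mate w (2 * k, r) =
    localMate (w k) (w (k + 1) = .inr true) (2 * k) (2 * k - 1) (2 * k + 1) r := by
  rw [mate, if_neg (by dsimp only; omega), show (2 * k, r).1 / 2 = k by dsimp only; omega]

theorem mate_even_succ (w : ℕ → Letter) (k : ℕ) (r : Fin 4) : mate w (2 * k + 2, r) =
    localMate (w (k + 1)) (w (k + 2) = .inr true) (2 * k + 2) (2 * k + 1) (2 * k + 3) r :=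
  mate_even w (k + 1) r

/-- The coordinate pairs of vertices of the polyomino graph. -/
def InGrid (n : ℕ) (x : ℕ × Fin 4) : Prop :=
  0 < n ∧ x.1 ≤ 2 * n ∧ (x.1 = 0 → x.2 = 1 ∨ x.2 = 2)

/-- Edges of the polyomino graph in terms of coordinates, directed downwards or to the right. -/
def GridEdge (x y : ℕ × Fin 4) : Prop :=
  (x.1 = y.1 ∧ x.2.val + 1 = y.2.val) ∨
    (x.2 = y.2 ∧ x.1 + 1 = y.1 ∧ (x.2 = 1 ∨ x.2 = 2 ∨ Odd x.1))

/-- The coordinates of a vertex. -/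
def pos {n : ℕ} (a : PolyominoVertex n) : ℕ × Fin 4 := (a.1.1.val, a.1.2)

theorem pos_injective {n : ℕ} : Function.Injective (pos (n := n)) := by
  rintro ⟨⟨i, r⟩, h⟩ ⟨⟨j, s⟩, h'⟩ e
  simp only [pos, Prod.mk.injEq] at e
  simp [Fin.ext_iff, e]

theorem inGrid_pos {n : ℕ} (a : PolyominoVertex n) : InGrid n (pos a) :=
  ⟨a.2.1, Nat.lt_succ_iff.1 a.1.1.2, a.2.2⟩

theorem InGrid.exists_pos {n : ℕ} {x : ℕ × Fin 4} (h : InGrid n x) :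
    ∃ a : PolyominoVertex n, pos a = x :=
  ⟨⟨(⟨x.1, Nat.lt_succ_iff.2 h.2.1⟩, x.2), h.1, h.2.2⟩, rfl⟩

theorem polyominoGraph_adj {n : ℕ} {a b : PolyominoVertex n} :
    (polyominoGraph n).Adj a b ↔ GridEdge (pos a) (pos b) ∨ GridEdge (pos b) (pos a) := by
  rw [polyominoGraph, SimpleGraph.fromRel_adj]
  simp only [GridEdge, pos, Fin.ext_iff]
  refine ⟨fun h => h.2, fun h => ⟨?_, h⟩⟩
  rintro rfl
  omega

theorem exists_column (n i : ℕ) (hi : i ≤ 2 * n) :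
    i = 0 ∨ ∃ k < n, i = 2 * k + 1 ∨ i = 2 * k + 2 := by
  rcases Nat.even_or_odd' i with ⟨k, rfl | rfl⟩
  · rcases k with _ | k
    · exact .inl rfl
    · exact .inr ⟨k, by omega, .inr rfl⟩
  · exact .inr ⟨k, by omega, .inl rfl⟩

/-- The check is local to a block and its neighbours. The link condition makes the two columns of a
link agree: if block `k + 1` is linked, the letter before it is not split and so sends its inner
vertices to the right. -/
theorem IsWord.mate_spec {n : ℕ} {w : ℕ → Letter} (hw : IsWord n w) {x : ℕ × Fin 4}
    (hx : InGrid n x) : InGrid n (mate w x) ∧ (GridEdge x (mate w x) ∨ GridEdge (mate w x) x) ∧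
      mate w (mate w x) = x := by
  obtain ⟨i, r⟩ := x
  obtain ⟨hn, hi, h0⟩ := hx
  dsimp only at hi h0
  have o : ∀ k, Odd (2 * k + 1) := fun k => ⟨k, rfl⟩
  rcases exists_column n i hi with rfl | ⟨k, hk, rfl | rfl⟩
  · have h1 := mate_even w 0
    have h2 := mate_odd w 0
    rw [hw.zero] at h1
    by_cases hc : w 1 = .inr true
    · rcases h0 rfl with rfl | rfl <;>
        simp_all [localMate, InGrid, GridEdge] <;> omega
    · rcases h0 rfl with rfl | rfl <;>
        simp_all [localMate, InGrid, GridEdge]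
  · have h1 := mate_even w k
    have h2 := mate_odd w k
    have h3 := mate_even_succ w k
    have h4 := hw.link k
    rcases hl : w (k + 1) with ⟨_ | _, _ | _⟩ | (_ | _)
    case inr.true =>
      rcases hl' : w k with _ | _
      · simp [hl, hl'] at h4
      · fin_cases r <;>
          simp [localMate, InGrid, GridEdge, Letter.top, Letter.bot, h1, h2, h3, hl, hl', hn] <;>
          omega
    all_goals
      fin_cases r <;>
        simp [localMate, InGrid, GridEdge, Letter.top, Letter.bot, h2, h3, hl, hn] <;> omega
  · have h1 := mate_even_succ w k
    have h2 := mate_odd w k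
    have h3 := mate_odd w (k + 1)
    have h5 := hw.tail (k + 2)
    rw [mul_add, mul_one, add_assoc] at h3
    by_cases hc : w (k + 2) = .inr true
    · have hk' : k + 1 < n := by
        by_contra hk'
        rw [h5 (by omega)] at hc
        simp at hc
      have h4 := hw.link (k + 1) hc
      rcases hl : w (k + 1) with _ | _
      · simp [hl] at h4
      · fin_cases r <;>
          simp [localMate, InGrid, GridEdge, Letter.top, Letter.bot, h1, h2, h3, hl, hc, hn] <;> omega
    · rcases hl : w (k + 1) with ⟨_ | _, _ | _⟩ | (_ | _) <;> fin_cases r <;>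
        simp [localMate, InGrid, GridEdge, Letter.top, Letter.bot, h1, h2, hl, hc, hn] <;> omega

/-- The spanning subgraph encoded by `w`. -/
def wordMatching (n : ℕ) (w : ℕ → Letter) : (polyominoGraph n).Subgraph where
  verts := Set.univ
  Adj a b := (polyominoGraph n).Adj a b ∧ mate w (pos a) = pos b ∧ mate w (pos b) = pos a
  adj_sub h := h.1
  edge_vert _ := trivial
  symm := ⟨fun _ _ h => ⟨h.1.symm, h.2.2, h.2.1⟩⟩

theorem IsWord.wordMatching_adj {n : ℕ} {w : ℕ → Letter} (hw : IsWord n w)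
    {a b : PolyominoVertex n} : (wordMatching n w).Adj a b ↔ mate w (pos a) = pos b := by
  refine ⟨fun h => h.2.1, fun h => ?_⟩
  have hs := hw.mate_spec (inGrid_pos a)
  rw [h] at hs
  exact ⟨polyominoGraph_adj.2 hs.2.1, h, hs.2.2⟩

theorem IsWord.isPerfectMatching {n : ℕ} {w : ℕ → Letter} (hw : IsWord n w) :
    (wordMatching n w).IsPerfectMatching := by
  refine ⟨fun a _ => ?_, fun _ => trivial⟩
  obtain ⟨b, hb⟩ := (hw.mate_spec (inGrid_pos a)).1.exists_pos
  refine ⟨b, hw.wordMatching_adj.2 hb.symm, fun c hc => pos_injective ?_⟩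
  rw [hb, hw.wordMatching_adj.1 hc]

/-- The partners of the two inner vertices in the left column of a block determine its letter. -/
theorem IsWord.mate_injective {n : ℕ} {w w' : ℕ → Letter} (hw : IsWord n w) (hw' : IsWord n w')
    (h : ∀ x, InGrid n x → mate w x = mate w' x) : w = w' := by
  funext k
  by_cases hk : n < k
  · rw [hw.tail k hk, hw'.tail k hk]
  rcases k with _ | k
  · rw [hw.zero, hw'.zero]
  have g : ∀ r, InGrid n (2 * k + 1, r) := fun r => ⟨by omega, by dsimp only; omega, by simp⟩
  have h1 := h _ (g 1)
  have h2 := h _ (g 2)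
  rw [mate_odd, mate_odd] at h1 h2
  rcases hl : w (k + 1) with ⟨_ | _, _ | _⟩ | (_ | _) <;>
    rcases hl' : w' (k + 1) with ⟨_ | _, _ | _⟩ | (_ | _) <;>
    simp_all [localMate]

theorem wordMatching_injOn {n : ℕ} {w w' : ℕ → Letter} (hw : IsWord n w) (hw' : IsWord n w')
    (h : wordMatching n w = wordMatching n w') : w = w' := by
  refine hw.mate_injective hw' fun x hx => ?_
  obtain ⟨a, rfl⟩ := hx.exists_pos
  obtain ⟨b, hb⟩ := (hw.mate_spec (inGrid_pos a)).1.exists_pos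
  have hab := hw.wordMatching_adj.2 hb.symm
  rw [h, hw'.wordMatching_adj] at hab
  rw [← hb, hab]

/-! ### From perfect matchings to words -/

/-- The local structure of a perfect matching on a block of eight vertices: `a`, `a'` and `o`, `o'`
are the edges to the preceding and to the following column, `p`, `c`, `q` the vertical edges and
`e₀, …, e₃` the horizontal ones. -/
theorem block_structure {a a' o o' p₁ c₁ q₁ p₂ c₂ q₂ e₀ e₁ e₂ e₃ : Prop} (ha : a ↔ a')
    (w₁ : (p₁ ∨ e₀) ∧ ¬(p₁ ∧ e₀)) (w₂ : (p₂ ∨ e₀) ∧ ¬(p₂ ∧ e₀))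
    (z₁ : (q₁ ∨ e₃) ∧ ¬(q₁ ∧ e₃)) (z₂ : (q₂ ∨ e₃) ∧ ¬(q₂ ∧ e₃))
    (u₁ : (p₁ ∨ c₁ ∨ e₁ ∨ a) ∧ ¬(p₁ ∧ c₁) ∧ ¬(p₁ ∧ e₁) ∧ ¬(p₁ ∧ a) ∧ ¬(c₁ ∧ e₁) ∧ ¬(c₁ ∧ a) ∧
      ¬(e₁ ∧ a))
    (v₁ : (q₁ ∨ c₁ ∨ e₂ ∨ a') ∧ ¬(q₁ ∧ c₁) ∧ ¬(q₁ ∧ e₂) ∧ ¬(q₁ ∧ a') ∧ ¬(c₁ ∧ e₂) ∧ ¬(c₁ ∧ a') ∧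
      ¬(e₂ ∧ a'))
    (u₂ : (p₂ ∨ c₂ ∨ e₁ ∨ o) ∧ ¬(p₂ ∧ c₂) ∧ ¬(p₂ ∧ e₁) ∧ ¬(p₂ ∧ o) ∧ ¬(c₂ ∧ e₁) ∧ ¬(c₂ ∧ o) ∧
      ¬(e₁ ∧ o))
    (v₂ : (q₂ ∨ c₂ ∨ e₂ ∨ o') ∧ ¬(q₂ ∧ c₂) ∧ ¬(q₂ ∧ e₂) ∧ ¬(q₂ ∧ o') ∧ ¬(c₂ ∧ e₂) ∧ ¬(c₂ ∧ o') ∧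
      ¬(e₂ ∧ o')) :
    (o ↔ o') ∧ (p₁ ↔ p₂) ∧ (q₁ ↔ q₂) ∧ (e₀ ↔ ¬p₁) ∧ (e₃ ↔ ¬q₁) ∧ (c₂ ↔ (a ∨ c₁) ∧ ¬o) ∧
      (a ∨ c₁ → ¬ p₁ ∧ ¬ q₁) ∧ (e₁ ↔ ¬a ∧ ¬c₁ ∧ ¬p₁) ∧ (e₂ ↔ ¬a ∧ ¬c₁ ∧ ¬q₁) ∧ (o → a ∨ c₁) ∧
      ¬(a ∧ c₁) := by
  obtain rfl := propext ha
  have hx : ∀ {p e : Prop}, (p ∨ e) ∧ ¬(p ∧ e) → e = ¬p := fun h => propext (by grind only)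
  have hy : ∀ {p e : Prop}, (p ∨ e) ∧ ¬(p ∧ e) → p = ¬e := fun h => propext (by grind only)
  -- The outer vertices have only two possible edges, so `e₀, e₃, p₂, q₂` are eliminated in favour
  -- of `p₁, q₁` before the case analysis.
  obtain rfl := hx w₁
  obtain rfl := hx z₁
  have h₂ := (hy w₂).trans (propext not_not)
  have h₄ := (hy z₂).trans (propext not_not)
  clear w₁ w₂ z₁ z₂ hx hy
  subst h₂ h₄
  refine ⟨?_, Iff.rfl, Iff.rfl, Iff.rfl, Iff.rfl, ?_, ?_, ?_, ?_, ?_, ?_⟩ <;> grind (splits := 40)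

/-- The edge relation of a subgraph in terms of coordinates. -/
def MatchedAt {n : ℕ} (M : (polyominoGraph n).Subgraph) (x y : ℕ × Fin 4) : Prop :=
  ∃ a b, M.Adj a b ∧ pos a = x ∧ pos b = y

section MatchedAt

variable {n : ℕ} {M : (polyominoGraph n).Subgraph} {x y : ℕ × Fin 4}

theorem matchedAt_pos {a b : PolyominoVertex n} : MatchedAt M (pos a) (pos b) ↔ M.Adj a b := by
  refine ⟨?_, fun h => ⟨a, b, h, rfl, rfl⟩⟩
  rintro ⟨a', b', h, ha, hb⟩
  rwa [← pos_injective ha, ← pos_injective hb]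

theorem matchedAt_comm : MatchedAt M x y ↔ MatchedAt M y x := by
  constructor <;> exact fun ⟨a, b, h, ha, hb⟩ => ⟨b, a, h.symm, hb, ha⟩

theorem MatchedAt.gridEdge (h : MatchedAt M x y) : GridEdge x y ∨ GridEdge y x := by
  obtain ⟨a, b, h, rfl, rfl⟩ := h
  exact polyominoGraph_adj.1 h.adj_sub

theorem MatchedAt.inGrid (h : MatchedAt M x y) : InGrid n x := by
  obtain ⟨a, b, h, rfl, rfl⟩ := h
  exact inGrid_pos a

theorem MatchedAt.unique (hM : M.IsPerfectMatching) {z : ℕ × Fin 4} (h : MatchedAt M x y)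
    (h' : MatchedAt M x z) : y = z := by
  obtain ⟨a, b, h, rfl, rfl⟩ := h
  obtain ⟨a', c, h', ha, rfl⟩ := h'
  obtain rfl := pos_injective ha
  exact congrArg pos ((hM.1 (hM.2 a')).unique h h')

theorem exists_matchedAt (hM : M.IsPerfectMatching) (hx : InGrid n x) : ∃ y, MatchedAt M x y := by
  obtain ⟨a, rfl⟩ := hx.exists_pos
  obtain ⟨b, hb, -⟩ := hM.1 (hM.2 a)
  exact ⟨pos b, matchedAt_pos.2 hb⟩

theorem matchedAt_two (hM : M.IsPerfectMatching) (hx : InGrid n x) {y z : ℕ × Fin 4}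
    (h : ∀ v, InGrid n v → GridEdge x v ∨ GridEdge v x → v = y ∨ v = z) (hyz : y ≠ z) :
    (MatchedAt M x y ∨ MatchedAt M x z) ∧ ¬(MatchedAt M x y ∧ MatchedAt M x z) := by
  refine ⟨?_, fun h' => hyz (h'.1.unique hM h'.2)⟩
  obtain ⟨v, hv⟩ := exists_matchedAt hM hx
  rcases h v (matchedAt_comm.1 hv).inGrid hv.gridEdge with rfl | rfl
  · exact .inl hv
  · exact .inr hv

/-- The candidates need not be vertices: `MatchedAt` is false outside the grid, so the last column
needs no separate treatment. -/
theorem matchedAt_four (hM : M.IsPerfectMatching) (hx : InGrid n x) {y z s t : ℕ × Fin 4}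
    (h : ∀ v, GridEdge x v ∨ GridEdge v x → v = y ∨ v = z ∨ v = s ∨ v = t)
    (h₁ : y ≠ z) (h₂ : y ≠ s) (h₃ : y ≠ t) (h₄ : z ≠ s) (h₅ : z ≠ t) (h₆ : s ≠ t) :
    (MatchedAt M x y ∨ MatchedAt M x z ∨ MatchedAt M x s ∨ MatchedAt M x t) ∧
      ¬(MatchedAt M x y ∧ MatchedAt M x z) ∧ ¬(MatchedAt M x y ∧ MatchedAt M x s) ∧
      ¬(MatchedAt M x y ∧ MatchedAt M x t) ∧ ¬(MatchedAt M x z ∧ MatchedAt M x s) ∧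
      ¬(MatchedAt M x z ∧ MatchedAt M x t) ∧ ¬(MatchedAt M x s ∧ MatchedAt M x t) := by
  have hu : ∀ {y z}, y ≠ z → ¬(MatchedAt M x y ∧ MatchedAt M x z) :=
    fun hne h' => hne (h'.1.unique hM h'.2)
  refine ⟨?_, hu h₁, hu h₂, hu h₃, hu h₄, hu h₅, hu h₆⟩
  obtain ⟨v, hv⟩ := exists_matchedAt hM hx
  rcases h v hv.gridEdge with rfl | rfl | rfl | rfl <;> simp [hv]

theorem matchedAt_block (hM : M.IsPerfectMatching) {m : ℕ} (hm : m < n)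
    (ha : MatchedAt M (2 * m + 1, 1) (2 * m, 1) ↔ MatchedAt M (2 * m + 1, 2) (2 * m, 2)) :
    let p₁ := MatchedAt M (2 * m + 1, 0) (2 * m + 1, 1)
    let c₁ := MatchedAt M (2 * m + 1, 1) (2 * m + 1, 2)
    let q₁ := MatchedAt M (2 * m + 1, 2) (2 * m + 1, 3)
    let a := MatchedAt M (2 * m + 1, 1) (2 * m, 1)
    let o := MatchedAt M (2 * m + 3, 1) (2 * m + 2, 1)
    (o ↔ MatchedAt M (2 * m + 3, 2) (2 * m + 2, 2)) ∧
      (p₁ ↔ MatchedAt M (2 * m + 2, 0) (2 * m + 2, 1)) ∧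
      (q₁ ↔ MatchedAt M (2 * m + 2, 2) (2 * m + 2, 3)) ∧
      (MatchedAt M (2 * m + 1, 0) (2 * m + 2, 0) ↔ ¬p₁) ∧
      (MatchedAt M (2 * m + 1, 3) (2 * m + 2, 3) ↔ ¬q₁) ∧
      (MatchedAt M (2 * m + 2, 1) (2 * m + 2, 2) ↔ (a ∨ c₁) ∧ ¬o) ∧
      (a ∨ c₁ → ¬ p₁ ∧ ¬ q₁) ∧
      (MatchedAt M (2 * m + 1, 1) (2 * m + 2, 1) ↔ ¬a ∧ ¬c₁ ∧ ¬p₁) ∧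
      (MatchedAt M (2 * m + 1, 2) (2 * m + 2, 2) ↔ ¬a ∧ ¬c₁ ∧ ¬q₁) ∧ (o → a ∨ c₁) ∧
      ¬(a ∧ c₁) := by
  have o : ∀ k, ¬ Odd (2 * k + 2) := fun k h => by rcases h with ⟨j, h⟩; omega
  have g₁ : ∀ r, InGrid n (2 * m + 1, r) := fun r => ⟨by omega, by dsimp only; omega, by simp⟩
  have g₂ : ∀ r, InGrid n (2 * m + 2, r) := fun r => ⟨by omega, by dsimp only; omega, by simp⟩
  have w₁ := matchedAt_two hM (g₁ 0) (y := (2 * m + 1, 1)) (z := (2 * m + 2, 0)) (by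
    rintro ⟨j, s⟩ -; fin_cases s <;> simp [GridEdge] <;> grind) (by simp)
  have z₁ := matchedAt_two hM (g₁ 3) (y := (2 * m + 1, 2)) (z := (2 * m + 2, 3)) (by
    rintro ⟨j, s⟩ -; fin_cases s <;> simp [GridEdge] <;> grind) (by simp)
  have w₂ := matchedAt_two hM (g₂ 0) (y := (2 * m + 2, 1)) (z := (2 * m + 1, 0)) (by
    rintro ⟨j, s⟩ -; fin_cases s <;> simp [GridEdge] <;> grind) (by simp)
  have z₂ := matchedAt_two hM (g₂ 3) (y := (2 * m + 2, 2)) (z := (2 * m + 1, 3)) (by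
    rintro ⟨j, s⟩ -; fin_cases s <;> simp [GridEdge] <;> grind) (by simp)
  have u₁ := matchedAt_four hM (g₁ 1) (y := (2 * m + 1, 0)) (z := (2 * m + 1, 2))
    (s := (2 * m + 2, 1)) (t := (2 * m, 1)) (by
      rintro ⟨j, s⟩; fin_cases s <;> simp [GridEdge] <;> omega)
      (by simp) (by simp) (by simp) (by simp) (by simp) (by simp)
  have v₁ := matchedAt_four hM (g₁ 2) (y := (2 * m + 1, 3)) (z := (2 * m + 1, 1))
    (s := (2 * m + 2, 2)) (t := (2 * m, 2)) (by
      rintro ⟨j, s⟩; fin_cases s <;> simp [GridEdge] <;> omega)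
      (by simp) (by simp) (by simp) (by simp) (by simp) (by simp)
  have u₂ := matchedAt_four hM (g₂ 1) (y := (2 * m + 2, 0)) (z := (2 * m + 2, 2))
    (s := (2 * m + 1, 1)) (t := (2 * m + 3, 1)) (by
      rintro ⟨j, s⟩; fin_cases s <;> simp [GridEdge] <;> omega)
      (by simp) (by simp) (by simp) (by simp) (by simp) (by simp)
  have v₂ := matchedAt_four hM (g₂ 2) (y := (2 * m + 2, 3)) (z := (2 * m + 2, 1))
    (s := (2 * m + 1, 2)) (t := (2 * m + 3, 2)) (by
      rintro ⟨j, s⟩; fin_cases s <;> simp [GridEdge] <;> omega)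
      (by simp) (by simp) (by simp) (by simp) (by simp) (by simp)
  rw [matchedAt_comm (x := (2 * m + 1, 1)) (y := (2 * m + 1, 0))] at u₁
  rw [matchedAt_comm (x := (2 * m + 1, 2)) (y := (2 * m + 1, 1))] at v₁
  rw [matchedAt_comm (x := (2 * m + 1, 3)) (y := (2 * m + 1, 2))] at z₁
  rw [matchedAt_comm (x := (2 * m + 2, 0)) (y := (2 * m + 1, 0))] at w₂
  rw [matchedAt_comm (x := (2 * m + 2, 3)) (y := (2 * m + 2, 2)),
    matchedAt_comm (x := (2 * m + 2, 3)) (y := (2 * m + 1, 3))] at z₂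
  rw [matchedAt_comm (x := (2 * m + 2, 1)) (y := (2 * m + 2, 0)),
    matchedAt_comm (x := (2 * m + 2, 1)) (y := (2 * m + 1, 1)),
    matchedAt_comm (x := (2 * m + 2, 1)) (y := (2 * m + 3, 1))] at u₂
  rw [matchedAt_comm (x := (2 * m + 2, 2)) (y := (2 * m + 2, 1)),
    matchedAt_comm (x := (2 * m + 2, 2)) (y := (2 * m + 1, 2)),
    matchedAt_comm (x := (2 * m + 2, 2)) (y := (2 * m + 3, 2))] at v₂
  exact block_structure ha w₁ w₂ z₁ z₂ u₁ v₁ u₂ v₂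

theorem matchedAt_left (hM : M.IsPerfectMatching) (hn : 0 < n) {r s : Fin 4}
    (h : r = 1 ∧ s = 2 ∨ r = 2 ∧ s = 1) :
    MatchedAt M (0, r) (0, s) ↔ ¬MatchedAt M (1, r) (0, r) := by
  have u := matchedAt_two hM (x := (0, r)) ⟨hn, by simp, fun _ => by grind⟩ (y := (0, s))
    (z := (1, r)) (by
      rintro ⟨j, t⟩ ⟨-, -, h'⟩
      rcases h with ⟨rfl, rfl⟩ | ⟨rfl, rfl⟩ <;> fin_cases t <;> simp [GridEdge] at h' ⊢ <;>
        omega) (by simp)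
  rw [matchedAt_comm (x := (1, r))]
  tauto

/-- The property spreads rightwards from the left end, each block passing it on. -/
theorem matchedAt_link_iff (hM : M.IsPerfectMatching) (m : ℕ) (hm : m ≤ n) :
    MatchedAt M (2 * m + 1, 1) (2 * m, 1) ↔ MatchedAt M (2 * m + 1, 2) (2 * m, 2) := by
  induction m with
  | zero =>
    rcases Nat.eq_zero_or_pos n with rfl | hn
    · exact iff_of_false (fun h => absurd h.inGrid.1 (lt_irrefl 0))
        fun h => absurd h.inGrid.1 (lt_irrefl 0)
    have u := matchedAt_left hM hn (.inl ⟨rfl, rfl⟩)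
    have v := matchedAt_left hM hn (.inr ⟨rfl, rfl⟩)
    rw [matchedAt_comm] at v
    exact not_iff_not.1 (u.symm.trans v)
  | succ m ih => exact (matchedAt_block hM (by omega) (ih (by omega))).1

end MatchedAt

open scoped Classical in
/-- The word that encodes a perfect matching. -/
noncomputable def wordOf {n : ℕ} (M : (polyominoGraph n).Subgraph) : ℕ → Letter
  | 0 => .inr false
  | m + 1 =>
    if MatchedAt M (2 * m + 1, 1) (2 * m, 1) then .inr true
    else if MatchedAt M (2 * m + 1, 1) (2 * m + 1, 2) then .inr false
    else .inl (MatchedAt M (2 * m + 1, 0) (2 * m + 1, 1), MatchedAt M (2 * m + 1, 2) (2 * m + 1, 3))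

section

variable {n : ℕ} {M : (polyominoGraph n).Subgraph}

theorem wordOf_succ_eq_true_iff (m : ℕ) :
    wordOf M (m + 1) = .inr true ↔ MatchedAt M (2 * m + 1, 1) (2 * m, 1) := by
  rw [wordOf]
  split_ifs <;> simp_all

theorem wordOf_succ_isRight_iff (m : ℕ) : (wordOf M (m + 1)).isRight ↔
    MatchedAt M (2 * m + 1, 1) (2 * m, 1) ∨ MatchedAt M (2 * m + 1, 1) (2 * m + 1, 2) := by
  rw [wordOf]
  split_ifs <;> simp_all

theorem isWord_wordOf (hM : M.IsPerfectMatching) : IsWord n (wordOf M) where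
  zero := rfl
  link k hk := by
    rcases k with _ | k
    · rfl
    rw [wordOf_succ_eq_true_iff] at hk
    rw [wordOf_succ_isRight_iff]
    have hkn : k < n := by have := hk.inGrid.2.1; dsimp only at this; omega
    exact (matchedAt_block hM hkn (matchedAt_link_iff hM k hkn.le)).2.2.2.2.2.2.2.2.2.1 hk
  tail k hk := by
    rcases k with _ | m
    · omega
    have hno : ∀ r y, ¬ MatchedAt M (2 * m + 1, r) y := fun r y h => by
      have := h.inGrid.2.1; dsimp only at this; omega
    simp [wordOf, hno]

theorem matchedAt_mate_block (hM : M.IsPerfectMatching) {m : ℕ} (hm : m < n) (r : Fin 4) :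
    MatchedAt M (2 * m + 1, r) (mate (wordOf M) (2 * m + 1, r)) ∧
      MatchedAt M (2 * m + 2, r) (mate (wordOf M) (2 * m + 2, r)) := by
  have ha := matchedAt_link_iff hM m hm.le
  have ho := wordOf_succ_eq_true_iff (M := M) (m + 1)
  rw [mate_odd, mate_even_succ]
  have hb := matchedAt_block hM hm ha
  dsimp only at hb
  obtain ⟨b₁, b₂, b₃, b₄, b₅, b₆, b₇, b₈, b₉, b₁₀, b₁₁⟩ := hb
  rw [show 2 * (m + 1) + 1 = 2 * m + 3 by ring, show 2 * (m + 1) = 2 * m + 2 by ring,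
    show m + 1 + 1 = m + 2 by ring] at ho
  -- Only the link bit of the next letter matters, so it is abstracted before `wordOf` is unfolded.
  generalize hc : decide (wordOf M (m + 2) = Sum.inr true) = c
  replace ho := (by rw [← hc, decide_eq_true_iff] : c = true ↔ _).trans ho
  simp only [wordOf]
  clear hc
  have c₁ := matchedAt_comm (M := M) (x := (2 * m + 1, 1)) (y := (2 * m + 1, 0))
  have c₂ := matchedAt_comm (M := M) (x := (2 * m + 1, 2)) (y := (2 * m + 1, 1))
  have c₃ := matchedAt_comm (M := M) (x := (2 * m + 1, 3)) (y := (2 * m + 1, 2))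
  have c₄ := matchedAt_comm (M := M) (x := (2 * m + 2, 1)) (y := (2 * m + 2, 0))
  have c₅ := matchedAt_comm (M := M) (x := (2 * m + 2, 2)) (y := (2 * m + 2, 1))
  have c₆ := matchedAt_comm (M := M) (x := (2 * m + 2, 3)) (y := (2 * m + 2, 2))
  have c₇ := fun s => matchedAt_comm (M := M) (x := (2 * m + 2, s)) (y := (2 * m + 1, s))
  have c₈ := fun s => matchedAt_comm (M := M) (x := (2 * m + 2, s)) (y := (2 * m + 3, s))
  by_cases h₁ : MatchedAt M (2 * m + 1, 1) (2 * m, 1)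
  · by_cases h₂ : MatchedAt M (2 * m + 3, 1) (2 * m + 2, 1) <;>
      fin_cases r <;> simp_all [localMate, Letter.top, Letter.bot]
  by_cases h₂ : MatchedAt M (2 * m + 1, 1) (2 * m + 1, 2)
  · by_cases h₃ : MatchedAt M (2 * m + 3, 1) (2 * m + 2, 1) <;>
      fin_cases r <;> simp_all [localMate, Letter.top, Letter.bot]
  by_cases h₃ : MatchedAt M (2 * m + 1, 0) (2 * m + 1, 1) <;>
    by_cases h₄ : MatchedAt M (2 * m + 1, 2) (2 * m + 1, 3) <;>
    fin_cases r <;> simp_all [localMate, Letter.top, Letter.bot]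

theorem matchedAt_mate (hM : M.IsPerfectMatching) {x : ℕ × Fin 4} (hx : InGrid n x) :
    MatchedAt M x (mate (wordOf M) x) := by
  obtain ⟨i, r⟩ := x
  rcases exists_column n i hx.2.1 with rfl | ⟨k, hk, rfl | rfl⟩
  · have h1 := mate_even (wordOf M) 0 r
    have hl := matchedAt_link_iff hM 0 (Nat.zero_le n)
    have ho := wordOf_succ_eq_true_iff (M := M) 0
    simp only [mul_zero, zero_add] at h1 hl ho
    have hu := matchedAt_left hM hx.1 (.inl ⟨rfl, rfl⟩)
    have hv := matchedAt_left hM hx.1 (.inr ⟨rfl, rfl⟩)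
    rw [h1]
    generalize hc : decide (wordOf M 1 = Sum.inr true) = c
    replace ho := (by rw [← hc, decide_eq_true_iff] : c = true ↔ _).trans ho
    clear hc
    have hc := fun s => matchedAt_comm (M := M) (x := (0, s)) (y := (1, s))
    rcases hx.2.2 rfl with h | h <;> dsimp only at h <;> subst h <;> rcases c with _ | _ <;>
      simp_all [localMate, wordOf]
  · exact (matchedAt_mate_block hM hk r).1
  · exact (matchedAt_mate_block hM hk r).2

theorem wordMatching_wordOf (hM : M.IsPerfectMatching) : wordMatching n (wordOf M) = M := by
  refine SimpleGraph.Subgraph.ext ?_ ?_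
  · exact (SimpleGraph.Subgraph.isSpanning_iff.1 hM.2).symm
  · funext a b
    rw [(isWord_wordOf hM).wordMatching_adj, ← matchedAt_pos]
    have h := matchedAt_mate hM (inGrid_pos a)
    exact propext ⟨fun e => e ▸ h, fun h' => h.unique hM h'⟩

end

open scoped Classical in
theorem sum_isPerfectMatching {A : Type*} [AddCommMonoid A] (n : ℕ)
    [Fintype (polyominoGraph n).Subgraph]
    [DecidablePred fun M : (polyominoGraph n).Subgraph => M.IsPerfectMatching]
    (f : (polyominoGraph n).Subgraph → A) :
    ∑ M : (polyominoGraph n).Subgraph with M.IsPerfectMatching, f M =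
      ∑ w : Fin n → Letter with IsWord n (extend w), f (wordMatching n (extend w)) := by
  symm
  refine Finset.sum_nbij (fun w => wordMatching n (extend w)) ?_ ?_ ?_ fun _ _ => rfl
  · intro w hw
    simp only [Finset.mem_filter, Finset.mem_univ, true_and] at hw ⊢
    exact hw.isPerfectMatching
  · intro w hw w' hw' h
    simp only [Finset.coe_filter, Finset.mem_univ, true_and, Set.mem_ofPred_eq] at hw hw'
    exact extend_injective (wordMatching_injOn hw hw' h)
  · intro M hM
    simp only [Finset.coe_filter, Finset.mem_univ, true_and, Set.mem_ofPred_eq] at hM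
    have hw := isWord_wordOf hM
    refine ⟨fun i => wordOf M (i + 1), ?_, ?_⟩
    · simp only [Finset.coe_filter, Finset.mem_univ, true_and, Set.mem_ofPred_eq]
      rwa [hw.extend_restrict]
    · dsimp only
      rw [hw.extend_restrict, wordMatching_wordOf hM]

/-! ### Upper bound: a forcing set of the size of the cost -/

/-- The indices of the cost of a word, letter by letter. -/
def units (n : ℕ) (w : ℕ → Letter) : Finset (ℕ × ℕ) :=
  (Finset.range n).biUnion fun k => (Finset.range ((phase w k).cost (w (k + 1)))).image (Prod.mk k)

theorem mem_units {n : ℕ} {w : ℕ → Letter} {c : ℕ × ℕ} :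
    c ∈ units n w ↔ c.1 < n ∧ c.2 < (phase w c.1).cost (w (c.1 + 1)) := by
  obtain ⟨k, t⟩ := c
  simp [units]

theorem card_units (n : ℕ) (w : ℕ → Letter) : (units n w).card = cost n w := by
  rw [units, Finset.card_biUnion, cost]
  · refine Finset.sum_congr rfl fun k _ => ?_
    rw [Finset.card_image_of_injective _ (Prod.mk_right_injective k), Finset.card_range]
  · intro i _ j _ hij
    rw [Function.onFun, Finset.disjoint_left]
    simp only [Finset.mem_image, not_exists, not_and]
    rintro _ ⟨_, _, rfl⟩ _ _ h
    exact hij (congrArg Prod.fst h).symm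

/-- The vertices whose matching edges make up a minimum forcing set. -/
def forcingVertex (w : ℕ → Letter) (c : ℕ × ℕ) : ℕ × Fin 4 :=
  match phase w c.1, w (c.1 + 1) with
  | _, .inl _ => (2 * c.1 + 1, if c.2 = 0 then 1 else 2)
  | .free, .inr _ => (2 * c.1 + 1, 1)
  | _, .inr _ => (2 * c.1 + 2, 1)

theorem forcingVertex_inGrid {n : ℕ} {w : ℕ → Letter} {c : ℕ × ℕ} (hc : c ∈ units n w) :
    InGrid n (forcingVertex w c) := by
  have h := (mem_units.1 hc).1
  rw [forcingVertex]
  split <;> refine ⟨by omega, by dsimp only; omega, by simp⟩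

theorem IsWord.exists_edge {n : ℕ} {w : ℕ → Letter} (hw : IsWord n w) {x : ℕ × Fin 4}
    (hx : InGrid n x) : ∃ e ∈ (wordMatching n w).edgeSet, ∀ w', IsWord n w' →
      e ∈ (wordMatching n w').edgeSet → mate w' x = mate w x := by
  obtain ⟨a, rfl⟩ := hx.exists_pos
  obtain ⟨b, hb⟩ := (hw.mate_spec (inGrid_pos a)).1.exists_pos
  refine ⟨s(a, b), hw.wordMatching_adj.2 hb.symm, fun w' hw' h => ?_⟩
  rw [← hb]
  exact hw'.wordMatching_adj.1 h

/-- The word is recovered from left to right. For an unlinked letter in phase `split` or `tied`, the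
prescribed edge lies in the right column, so it also reveals whether the next letter is linked. This
is the second clause of `key`, and the reason why a linked letter is then free. -/
theorem IsWord.eq_of_mate_forcingVertex {n : ℕ} {w w' : ℕ → Letter} (hw : IsWord n w)
    (hw' : IsWord n w')
    (h : ∀ c ∈ units n w, mate w' (forcingVertex w c) = mate w (forcingVertex w c)) : w' = w := by
  have key : ∀ k ≤ n, w' k = w k ∧
      (phase w k = .tied → (w' (k + 1) = .inr true ↔ w (k + 1) = .inr true)) := by
    intro k hk
    induction k with
    | zero => exact ⟨hw'.zero.trans hw.zero.symm, fun h => by simp [phase] at h⟩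
    | succ k ih =>
      obtain ⟨h₁, h₂⟩ := ih (by omega)
      have g : ∀ t, t < (phase w k).cost (w (k + 1)) → _ := fun t ht =>
        h (k, t) (mem_units.2 ⟨hk, ht⟩)
      have l := hw.link k
      have l' := hw'.link k
      have hs := phase_eq_split_iff hw.zero k
      have hp : phase w (k + 1) = (phase w k).next (w (k + 1)) := rfl
      simp only [forcingVertex] at g
      rcases hwk : w (k + 1) with ⟨p, q⟩ | b
      · have g₀ := g 0 (by simp [hwk, Phase.cost])
        have g₁ := g 1 (by simp [hwk, Phase.cost])
        simp only [hwk, if_true, one_ne_zero, if_false, mate_odd] at g₀ g₁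
        refine ⟨?_, fun ht => by simp [hp, hwk, Phase.next] at ht⟩
        rcases hwk' : w' (k + 1) with ⟨p', q'⟩ | (_ | _) <;> rw [hwk'] at g₀ g₁ <;>
          rcases p with _ | _ <;> rcases q with _ | _ <;> simp [localMate] at g₀ g₁ ⊢
        all_goals grind
      · rcases hph : phase w k
        · have g₀ := g 0 (by simp [hwk, hph, Phase.cost])
          simp only [hwk, hph, mate_odd] at g₀
          refine ⟨?_, fun ht => by simp [hp, hwk, hph, Phase.next] at ht⟩
          rcases hwk' : w' (k + 1) with ⟨_ | _, _⟩ | (_ | _) <;> rw [hwk'] at g₀ <;>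
            rcases b with _ | _ <;> simp [localMate] at g₀ ⊢
        all_goals
          rcases b with _ | _
          · have g₀ := g 0 (by simp [hwk, hph, Phase.cost])
            simp only [hwk, hph, mate_even_succ] at g₀
            rcases hwk' : w' (k + 1) with ⟨_ | _, _⟩ | (_ | _) <;> rw [hwk'] at g₀ <;>
              by_cases hc : w (k + 2) = .inr true <;> by_cases hc' : w' (k + 2) = .inr true <;>
              simp_all [localMate]
          -- A linked letter is impossible after a split one; in phase `tied` it is already known
          -- from the second clause of the induction hypothesis.
          · simp_all [Phase.next]
  funext k
  by_cases hk : k ≤ n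
  · exact (key k hk).1
  · rw [hw.tail k (by omega), hw'.tail k (by omega)]

theorem IsWord.forcingNumber_le {n : ℕ} {w : ℕ → Letter} (hw : IsWord n w) :
    forcingNumber (wordMatching n w) ≤ cost n w := by
  classical
  choose e he he' using fun x (hx : InGrid n x) => hw.exists_edge hx
  let S := (units n w).attach.image fun c => e _ (forcingVertex_inGrid c.2)
  have hS : IsForcingSet (wordMatching n w) S := by
    refine ⟨?_, fun M' hM' hsub => ?_⟩
    · intro s hs
      simp only [S, Finset.coe_image, Set.mem_image] at hs
      obtain ⟨c, -, rfl⟩ := hs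
      exact he _ _
    · rw [← wordMatching_wordOf hM'] at hsub ⊢
      have hw' := isWord_wordOf hM'
      rw [hw.eq_of_mate_forcingVertex hw' fun c hc => ?_]
      refine he' _ (forcingVertex_inGrid hc) _ hw' (hsub ?_)
      exact Finset.mem_image_of_mem _ (Finset.mem_attach _ ⟨c, hc⟩)
  have hle : forcingNumber (wordMatching n w) ≤ S.card := Nat.sInf_le ⟨S, hS, rfl⟩
  refine hle.trans (Finset.card_image_le.trans ?_)
  rw [Finset.card_attach, card_units]

/-! ### Lower bound: disjoint alternating squares -/

/-- A forcing set is not contained in the matching of `f c`, so it has an edge on which the two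
matchings differ. Both ends of that edge are owned by `c`; hence distinct `c` receive distinct
edges. -/
theorem IsWord.card_le_card {n : ℕ} {w : ℕ → Letter} (hw : IsWord n w) {ι : Type*}
    {U : Finset ι} (f : ι → ℕ → Letter) (owner : ℕ × Fin 4 → ι)
    (hf : ∀ c ∈ U, IsWord n (f c) ∧ f c ≠ w ∧ ∀ x, mate w x ≠ mate (f c) x → owner x = c)
    {S : Finset (Sym2 (PolyominoVertex n))} (hS : IsForcingSet (wordMatching n w) S) :
    U.card ≤ S.card := by
  have h : ∀ c ∈ U, ∃ e ∈ S, ∀ a ∈ e, owner (pos a) = c := by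
    intro c hc
    obtain ⟨h₁, h₂, h₃⟩ := hf c hc
    have hn : ¬ (S : Set (Sym2 (PolyominoVertex n))) ⊆ (wordMatching n (f c)).edgeSet :=
      fun hsub => h₂ (wordMatching_injOn h₁ hw (hS.2 _ h₁.isPerfectMatching hsub))
    obtain ⟨e, heS, he⟩ := Set.not_subset.1 hn
    refine ⟨e, heS, fun a ha => h₃ _ ?_⟩
    obtain ⟨b, rfl⟩ := ha
    rw [hw.wordMatching_adj.1 (hS.1 heS)]
    exact fun h => he (h₁.wordMatching_adj.2 h.symm)
  rcases U.eq_empty_or_nonempty with rfl | ⟨c₀, hc₀⟩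
  · simp
  have : Nonempty (Sym2 (PolyominoVertex n)) := ⟨(h c₀ hc₀).choose⟩
  choose! e he he' using h
  refine Finset.card_le_card_of_injOn e he fun c hc c' hc' hcc => ?_
  have h₁ := he' c hc _ (Sym2.out_fst_mem (e c))
  rw [← h₁]
  exact he' c' hc' _ (hcc ▸ Sym2.out_fst_mem (e c))

theorem IsWord.update {n : ℕ} {w : ℕ → Letter} (hw : IsWord n w) {j : ℕ} (hj : j < n) (l : Letter)
    (h₁ : l = .inr true → (w j).isRight) (h₂ : w (j + 2) = .inr true → l.isRight) :
    IsWord n (Function.update w (j + 1) l) where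
  zero := by rw [Function.update_of_ne (by omega), hw.zero]
  link k := by
    by_cases hk : k = j
    · subst hk
      rwa [Function.update_self, Function.update_of_ne (by omega)]
    · rw [Function.update_of_ne (by omega)]
      by_cases hk' : k = j + 1
      · subst hk'
        rwa [Function.update_self]
      · rw [Function.update_of_ne hk']
        exact hw.link k
  tail k hk := by rw [Function.update_of_ne (by omega), hw.tail k hk]

/-- Only the changed block can be affected, and the column to its left if the link status changes.
In the last case both sides have the same bit `c`, since it belongs to the following letter. -/
theorem mate_update_ne {w : ℕ → Letter} {j : ℕ} {l : Letter} {x : ℕ × Fin 4}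
    (h : mate w x ≠ mate (Function.update w (j + 1) l) x) :
    (x.1 = 2 * j ∧ (w (j + 1) = .inr true ↔ ¬ l = .inr true)) ∨
      (x.1 = 2 * j + 1 ∧
        localMate (w (j + 1)) (w (j + 1) = .inr true) (2 * j + 1) (2 * j + 2) (2 * j) x.2 ≠
          localMate l (l = .inr true) (2 * j + 1) (2 * j + 2) (2 * j) x.2) ∨
      (x.1 = 2 * j + 2 ∧ ∃ c : Bool,
        localMate (w (j + 1)) c (2 * j + 2) (2 * j + 1) (2 * j + 3) x.2 ≠
          localMate l c (2 * j + 2) (2 * j + 1) (2 * j + 3) x.2) := by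
  obtain ⟨i, r⟩ := x
  rcases Nat.even_or_odd' i with ⟨m, rfl | rfl⟩
  · rw [mate_even, mate_even] at h
    by_cases h₁ : m = j
    · subst h₁
      rw [Function.update_of_ne (by omega), Function.update_self] at h
      refine .inl ⟨rfl, ?_⟩
      by_contra hc
      refine h ?_
      congr 1
      rw [decide_eq_decide]
      tauto
    · rw [Function.update_of_ne (a := m + 1) (by omega)] at h
      by_cases h₂ : m = j + 1
      · subst h₂
        rw [Function.update_self] at h
        exact .inr (.inr ⟨rfl, _, h⟩)
      · rw [Function.update_of_ne h₂] at h
        exact absurd rfl h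
  · rw [mate_odd, mate_odd] at h
    by_cases h₁ : m = j
    · subst h₁
      rw [Function.update_self] at h
      exact .inr (.inl ⟨rfl, h⟩)
    · rw [Function.update_of_ne (by omega)] at h
      exact absurd rfl h

/-- For each unit of cost, a word whose matching differs from that of `w` in an alternating
square. -/
def flipWord (w : ℕ → Letter) (c : ℕ × ℕ) : ℕ → Letter :=
  match phase w c.1, w (c.1 + 1) with
  | _, .inl (p, q) =>
    Function.update w (c.1 + 1) (.inl (if c.2 = 0 then (!p, q) else (p, !q)))
  | .free, .inr h => Function.update w (c.1 + 1) (.inr !h)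
  | _, .inr _ =>
    if w (c.1 + 2) = .inr true then Function.update w (c.1 + 2) (.inr false)
    else Function.update w (c.1 + 1) (.inl (false, false))

/-- The number of the alternating square in the block that a vertex in row `r` belongs to. -/
def slot (l : Letter) (r : Fin 4) : ℕ :=
  if l.isLeft ∧ 2 ≤ r.val then 1 else 0

open scoped Classical in
/-- The unit of cost whose alternating square contains a given vertex, if there is one. -/
noncomputable def owner (w : ℕ → Letter) (x : ℕ × Fin 4) : ℕ × ℕ :=
  if x.1 % 2 = 1 then
    if phase w (x.1 / 2) = .tied ∧ w (x.1 / 2 + 1) = .inr true then (x.1 / 2 - 1, 0)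
    else (x.1 / 2, slot (w (x.1 / 2 + 1)) x.2)
  else if phase w (x.1 / 2) = .free ∧ (w (x.1 / 2 + 1)).isRight then (x.1 / 2, 0)
    else (x.1 / 2 - 1, slot (w (x.1 / 2)) x.2)

open scoped Classical in
theorem owner_odd (w : ℕ → Letter) (k : ℕ) (r : Fin 4) : owner w (2 * k + 1, r) =
    if phase w k = .tied ∧ w (k + 1) = .inr true then (k - 1, 0) else (k, slot (w (k + 1)) r) := by
  rw [owner, if_pos (by dsimp only; omega), show (2 * k + 1, r).1 / 2 = k by dsimp only; omega]

open scoped Classical in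
theorem owner_even (w : ℕ → Letter) (k : ℕ) (r : Fin 4) : owner w (2 * k, r) =
    if phase w k = .free ∧ (w (k + 1)).isRight then (k, 0) else (k - 1, slot (w k) r) := by
  rw [owner, if_neg (by dsimp only; omega), show (2 * k, r).1 / 2 = k by dsimp only; omega]

open scoped Classical in
theorem owner_even_succ (w : ℕ → Letter) (k : ℕ) (r : Fin 4) : owner w (2 * k + 2, r) =
    if phase w (k + 1) = .free ∧ (w (k + 2)).isRight then (k + 1, 0)
      else (k, slot (w (k + 1)) r) :=
  owner_even w (k + 1) r

/-- The squares are: the upper or lower one of a split block; in phase `free`, the one joining the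
block to the column on its left; otherwise the one joining it to the next block if that is linked,
and its own middle square if not. That `owner` is a function expresses their disjointness. -/
theorem IsWord.flipWord_spec {n : ℕ} {w : ℕ → Letter} (hw : IsWord n w) {c : ℕ × ℕ}
    (hc : c ∈ units n w) : IsWord n (flipWord w c) ∧ flipWord w c ≠ w ∧
      ∀ x, mate w x ≠ mate (flipWord w c) x → owner w x = c := by
  obtain ⟨k, t⟩ := c
  obtain ⟨hk, ht⟩ := mem_units.1 hc
  dsimp only at hk ht
  have l := hw.link k
  have l₁ := hw.link (k + 1)
  have hs := phase_eq_split_iff hw.zero k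
  have hp : phase w (k + 1) = (phase w k).next (w (k + 1)) := rfl
  rw [flipWord]
  dsimp only
  have hne : ∀ {j l}, l ≠ w j → Function.update w j l ≠ w := fun h h' =>
    h ((Function.update_self _ _ w).symm.trans (congrFun h' _))
  have ht3 : ∀ {p q t}, t < Phase.cost p (.inl q) → t = 0 ∨ t = 1 := by
    intro p q t h
    simp only [Phase.cost] at h
    omega
  rcases hwk : w (k + 1) with ⟨p, q⟩ | b
  · have hph : phase w (k + 1) = .split := by rw [hp, hwk]; rfl
    have hl₂ : w (k + 2) ≠ .inr true := fun h => by simpa [hwk] using l₁ h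
    rw [hwk] at ht
    dsimp only
    refine ⟨hw.update hk _ (by simp) fun h => absurd h hl₂, hne ?_, fun ⟨i, r⟩ hx => ?_⟩
    · rw [hwk]; split_ifs <;> simp
    · rcases mate_update_ne hx with ⟨h, h'⟩ | ⟨h, h'⟩ | ⟨h, e, h'⟩ <;> dsimp only at h h' <;> subst h
      · simp [hwk] at h'
      · rw [owner_odd, hwk, if_neg (by simp)]
        rw [hwk] at h'
        rcases ht3 ht with rfl | rfl <;> rcases p with _ | _ <;> rcases q with _ | _ <;>
          fin_cases r <;> simp [localMate, Letter.top, Letter.bot, slot] at h' ⊢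
      · rw [owner_even_succ, hwk, hph, if_neg (by simp)]
        rw [hwk] at h'
        rcases ht3 ht with rfl | rfl <;> rcases p with _ | _ <;> rcases q with _ | _ <;>
          fin_cases r <;> simp [localMate, Letter.top, Letter.bot, slot] at h' ⊢
  -- The phases `split` and `tied` share this argument. In both the letter is unlinked: a link after
  -- a split block is forbidden, and one in phase `tied` has no unit of cost.
  · have tied (hph : phase w k ≠ .free) (hb : b = false) : IsWord n
        (if w (k + 2) = .inr true then Function.update w (k + 2) (.inr false)
          else Function.update w (k + 1) (.inl (false, false))) ∧
        (if w (k + 2) = .inr true then Function.update w (k + 2) (.inr false)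
          else Function.update w (k + 1) (.inl (false, false))) ≠ w ∧
        ∀ x, mate w x ≠ mate (if w (k + 2) = .inr true then Function.update w (k + 2) (.inr false)
          else Function.update w (k + 1) (.inl (false, false))) x → owner w x = (k, 0) := by
      subst hb
      have hph' : phase w (k + 1) = .tied := by
        rw [hp, hwk]; rcases h : phase w k <;> simp_all [Phase.next]
      split_ifs with h₂
      · have hk' : k + 1 < n := by
          by_contra hk'
          rw [hw.tail _ (by omega)] at h₂
          simp at h₂
        refine ⟨hw.update hk' _ (by simp) fun _ => rfl, hne (by simp [h₂]), fun ⟨i, r⟩ hx => ?_⟩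
        rcases mate_update_ne hx with ⟨h, h'⟩ | ⟨h, h'⟩ | ⟨h, e, h'⟩ <;> dsimp only at h h' <;>
          subst h
        · rw [owner_even, hph', hwk, if_neg (by simp)]
          simp [slot]
        · rw [owner_odd, if_pos ⟨hph', h₂⟩]
          simp
        · rw [h₂] at h'
          fin_cases r <;> simp [localMate, Letter.top, Letter.bot] at h'
      · refine ⟨hw.update hk _ (by simp) fun h => absurd h h₂, hne (by simp [hwk]),
          fun ⟨i, r⟩ hx => ?_⟩
        rcases mate_update_ne hx with ⟨h, h'⟩ | ⟨h, h'⟩ | ⟨h, e, h'⟩ <;> dsimp only at h h' <;>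
          subst h
        · simp [hwk] at h'
        · rw [owner_odd, hwk, if_neg (by simp)]
          simp [slot]
        · rw [owner_even_succ, hph', hwk, if_neg (by simp)]
          simp [slot]
    rcases hph : phase w k
    · obtain rfl : t = 0 := by simpa [hwk, hph, Phase.cost] using ht
      have hr : (w k).isRight := by
        by_contra h
        rw [hs.2 h] at hph
        cases hph
      dsimp only
      refine ⟨hw.update hk _ (fun _ => hr) fun _ => rfl, hne (by simp [hwk]), fun ⟨i, r⟩ hx => ?_⟩
      rcases mate_update_ne hx with ⟨h, h'⟩ | ⟨h, h'⟩ | ⟨h, e, h'⟩ <;> dsimp only at h h' <;>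
        subst h
      · rw [owner_even, hwk, if_pos ⟨hph, rfl⟩]
      · rw [owner_odd, hwk, hph, if_neg (by simp)]
        simp [slot]
      · rw [hwk] at h'
        fin_cases r <;> simp [localMate, Letter.top, Letter.bot] at h'
    · have hb : b = false := by
        rcases b with _ | _
        · rfl
        · exact absurd (l hwk) (hs.1 hph)
      obtain rfl : t = 0 := by simpa [hwk, hph, hb, Phase.cost] using ht
      exact tied (by simp [hph]) hb
    · have hb : b = false := by
        rcases b with _ | _
        · rfl
        · simp [hwk, hph, Phase.cost] at ht
      obtain rfl : t = 0 := by simpa [hwk, hph, hb, Phase.cost] using ht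
      exact tied (by simp [hph]) hb

theorem IsWord.forcingNumber_eq {n : ℕ} {w : ℕ → Letter} (hw : IsWord n w) :
    forcingNumber (wordMatching n w) = cost n w := by
  refine le_antisymm hw.forcingNumber_le ?_
  -- Some forcing set must exist for the infimum to be attained, since `sInf ∅ = 0`.
  obtain ⟨S, hS⟩ := exists_isForcingSet _ hw.isPerfectMatching
  obtain ⟨S, hS, hcard⟩ := Nat.sInf_mem (s := {k : ℕ | ∃ S : Finset (Sym2 (PolyominoVertex n)),
    IsForcingSet (wordMatching n w) S ∧ S.card = k}) ⟨S.card, S, hS, rfl⟩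
  rw [forcingNumber, ← hcard, ← card_units]
  exact hw.card_le_card (flipWord w) (owner w) (fun c hc => hw.flipWord_spec hc) hS

/-! ### The forcing polynomial and its coefficients -/

theorem forcingPolynomial_polyominoGraph (n : ℕ) : forcingPolynomial (polyominoGraph n) =
    X ^ n * (transferPoly n - if n = 0 then 0 else transferPoly (n - 1)) := by
  classical
  rw [← sum_word_cost, forcingPolynomial, sum_isPerfectMatching]
  refine Finset.sum_congr rfl fun w hw => ?_
  rw [IsWord.forcingNumber_eq (Finset.mem_filter.1 hw).2]

/-- The top term comes from `transferPoly (n + 1)` alone, the other polynomial having smaller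
degree. -/
theorem transferPoly_sub (n : ℕ) : transferPoly (n + 1) - transferPoly n =
    2 ^ (2 * (n + 1)) * X ^ (n + 1) + ∑ m ∈ Finset.range (n + 1),
      C ((transferPoly (n + 1)).coeff m - (transferPoly n).coeff m) * X ^ m := by
  have hd : (transferPoly (n + 1) - transferPoly n).natDegree < n + 2 := by
    rw [Nat.lt_succ_iff, natDegree_le_iff_coeff_eq_zero]
    intro m hm
    rw [coeff_sub, transferPoly_coeff_of_le _ _ hm.le, transferPoly_coeff_of_le _ _ (by omega),
      if_neg (by omega), if_neg (by omega), sub_zero]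
  conv_lhs => rw [as_sum_range_C_mul_X_pow' _ hd]
  rw [Finset.sum_range_succ, add_comm]
  congr 1
  · rw [coeff_sub, transferPoly_coeff_of_le _ _ le_rfl, transferPoly_coeff_of_le _ _ (by omega),
      if_pos rfl, if_neg (by omega), sub_zero, pow_mul]
    norm_num

theorem theorem3p2 (n : ℕ) :
    forcingPolynomial (polyominoGraph n) =
      2 ^ (2 * n) * X ^ (2 * n) +
        X ^ n * ∑ m ∈ Finset.range n,
          C ((∑ i ∈ Finset.Icc (max (n ⌈/⌉ 3) m) n,
                ∑ j ∈ Finset.Icc (max ((n - i) ⌈/⌉ 2) (m + n - 2 * i)) (n - i),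
                  ∑ k ∈ Finset.Icc (m - (i + 2 * j - n)) m,
                    (-1 : ℤ) ^ (i + 2 * j - n) * 2 ^ (n + 2 * m - i) * 3 ^ (i - j - k) *
                      (i.choose j : ℤ) * (j.choose (n - i - j) : ℤ) *
                      ((i - j).choose k : ℤ) * ((i + 2 * j - n).choose (m - k) : ℤ)) -
              ∑ i ∈ Finset.Icc (max ((n - 1) ⌈/⌉ 3) m) (n - 1),
                ∑ j ∈ Finset.Icc (max ((n - i - 1) ⌈/⌉ 2) (m + n - 2 * i - 1)) (n - i - 1),
                  ∑ k ∈ Finset.Icc (m - (i + 2 * j + 1 - n)) m,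
                    (-1 : ℤ) ^ (i + 2 * j + 1 - n) * 2 ^ (n + 2 * m - i - 1) * 3 ^ (i - j - k) *
                      (i.choose j : ℤ) * (j.choose (n - i - j - 1) : ℤ) *
                      ((i - j).choose k : ℤ) * ((i + 2 * j + 1 - n).choose (m - k) : ℤ)) *
            X ^ m := by
  rw [forcingPolynomial_polyominoGraph]
  rcases n with _ | n
  -- For the null graph both sides are 1; the truncated `n - 1` occurs only inside an empty sum.
  · simp [transferPoly_zero]
  rw [if_neg (by omega), Nat.add_sub_cancel, transferPoly_sub, mul_add]
  congr 1
  · ring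
  congr 1
  refine Finset.sum_congr rfl fun m _ => ?_
  congr 2
  rw [transferPoly_coeff, transferPoly_coeff]
  congr 1
  refine Finset.sum_congr rfl fun i hi => ?_
  rw [Finset.mem_Icc] at hi
  rw [show n + 1 - i - 1 = n - i by omega, show m + (n + 1) - 2 * i - 1 = m + n - 2 * i by omega]
  refine Finset.sum_congr rfl fun j _ => ?_
  -- In `B` the 1 is added before `n` is subtracted; added after a truncated subtraction, it would
  -- give the wrong exponent when `i + 2j` is smaller than the number of blocks.
  rw [show i + 2 * j + 1 - (n + 1) = i + 2 * j - n by omega,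
    show n + 1 + 2 * m - i - 1 = n + 2 * m - i by omega,
    show n + 1 - i - j - 1 = n - i - j by omega]
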